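/- All graphs are finite and simple. A \emph{convex drawing} of a graph places its vertices on different points of a circle in the Euclidean plane and draws every edge as the straight-line segment between its endpoints. Two different edges \emph{cross} in such a drawing if their segments have a common interior point. A graph is \emph{outer $2$-planar} if it admits a convex drawing in which every edge crosses at most two other edges. A \emph{tree decomposition} of a graph $G$ is a finite tree whose nodes carry sets of vertices of $G$ (\emph{bags}) such that every vertex and every edge of $G$ is contained in some bag and, for every vertex $v$, the nodes whose bags contain $v$ induce a subtree. Its \emph{width} is the maximum size of a bag minus one, and the \emph{treewidth} $\operatorname{tw}(G)$ is the minimum width over all tree decompositions of $G$. \textbf{Theorem.} Every outer $2$-planar graph $G$ satisfies $\operatorname{tw}(G) \le 4$. This bound is tight: the complete graph $K_5$ is outer $2$-planar and $\operatorname{tw}(K_5) = 4$. -/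

import Mathlib

universe u

/-- A tree decomposition of a graph `G`: a finite tree `tree` whose nodes `i : ι` carry bags
`bag i` of vertices of `G`, such that the bags cover the vertices, every edge lies in some bag,
and, for every vertex `v`, the nodes whose bags contain `v` induce a subtree. -/
structure TreeDecomposition {V : Type u} (G : SimpleGraph V) where
  ι : Type
  [fintypeι : Fintype ι]
  tree : SimpleGraph ι
  isTree : tree.IsTree
  bag : ι → Finset V
  vertex_mem : ∀ v : V, ∃ i, v ∈ bag i
  edge_mem : ∀ v w : V, G.Adj v w → ∃ i, v ∈ bag i ∧ w ∈ bag i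
  subtree : ∀ v : V, (tree.induce {i | v ∈ bag i}).Connected

attribute [instance] TreeDecomposition.fintypeι

/-- The width of a tree decomposition: the maximum size of a bag, minus one (an integer, so that
the width is `-1` if all the bags are empty). -/
def TreeDecomposition.width {V : Type u} {G : SimpleGraph V} (D : TreeDecomposition G) : ℤ :=
  ((Finset.univ.sup fun i => (D.bag i).card : ℕ) : ℤ) - 1

/-- The treewidth of a finite graph: the minimum width over all its tree decompositions. -/
noncomputable def treewidth {V : Type u} [Finite V] (G : SimpleGraph V) : ℤ :=
  sInf (Set.range fun D : TreeDecomposition G => D.width)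

/-- The minimum in the definition of the treewidth is attained: the set of widths is non-empty and
bounded below. -/
theorem isLeast_treewidth {V : Type u} [Finite V] (G : SimpleGraph V) :
    IsLeast (Set.range fun D : TreeDecomposition G => D.width) (treewidth G) := by
  have hne : (Set.range fun D : TreeDecomposition G => D.width).Nonempty := by
    have := Fintype.ofFinite V
    refine ⟨_, ⟨{ ι := Unit
                  tree := ⊥
                  isTree := SimpleGraph.IsTree.of_subsingleton
                  bag := fun _ => Finset.univ
                  vertex_mem := fun v => ⟨(), Finset.mem_univ v⟩
                  edge_mem := fun v w _ => ⟨(), Finset.mem_univ v, Finset.mem_univ w⟩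
                  subtree := fun v => ?_ }, rfl⟩⟩
    have : Nonempty ↑{i : Unit | v ∈ (fun _ => (Finset.univ : Finset V)) i} :=
      ⟨⟨(), Finset.mem_univ v⟩⟩
    exact SimpleGraph.IsTree.of_subsingleton.connected
  have hbd : BddBelow (Set.range fun D : TreeDecomposition G => D.width) := by
    refine ⟨-1, ?_⟩
    rintro _ ⟨D, rfl⟩
    simp only [TreeDecomposition.width]
    omega
  exact ⟨Int.csInf_mem hne hbd, fun x hx => csInf_le hbd hx⟩

/-- The Euclidean plane. -/
abbrev Plane : Type := EuclideanSpace ℝ (Fin 2)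

/-- A convex drawing of a graph with vertex set `V`: the vertices are placed on different points
of a circle; every edge is drawn as the straight-line segment between its endpoints. -/
structure ConvexDrawing (V : Type u) where
  center : Plane
  radius : ℝ
  radius_pos : 0 < radius
  pos : V → Plane
  pos_mem : ∀ v, pos v ∈ Metric.sphere center radius
  pos_injective : Function.Injective pos

/-- The straight-line segment, without its endpoints, that represents the vertex pair `e`. -/
def ConvexDrawing.openEdge {V : Type u} (Γ : ConvexDrawing V) (e : Sym2 V) : Set Plane :=
  Sym2.lift ⟨fun v w => openSegment ℝ (Γ.pos v) (Γ.pos w),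
    fun v w => openSegment_symm ℝ (Γ.pos v) (Γ.pos w)⟩ e

/-- Two different edges cross in a drawing if their segments have a common interior point. -/
def ConvexDrawing.Crosses {V : Type u} (Γ : ConvexDrawing V) (e f : Sym2 V) : Prop :=
  e ≠ f ∧ (Γ.openEdge e ∩ Γ.openEdge f).Nonempty

/-- An outer `k`-planar drawing of `G`: a convex drawing such that every edge of `G` crosses at
most `k` other edges of `G`. -/
def ConvexDrawing.IsOuterKPlanar {V : Type u} (Γ : ConvexDrawing V) (k : ℕ)
    (G : SimpleGraph V) : Prop :=
  ∀ e ∈ G.edgeSet, {f ∈ G.edgeSet | Γ.Crosses e f}.encard ≤ k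

/-- A graph is outer `k`-planar if it admits an outer `k`-planar drawing. -/
def OuterKPlanar {V : Type u} (k : ℕ) (G : SimpleGraph V) : Prop :=
  ∃ Γ : ConvexDrawing V, Γ.IsOuterKPlanar k G

/-! Upper bound: number the vertices by angle. Interleaving pairs give intersecting chords, so every
edge interleaves with at most two others. For a chord (a, b), which need not be an edge, the graph
on [a, b] gets a decomposition whose root bag consists of a, b and the inner endpoints of the edges
crossing the chord. The recursion splits at some c between a and b, and each chord met may be
crossed by at most two edges.

This bound alone is not inherited. If c is the inner end of an edge e across (a, b), the new sides
may be crossed by two edges that cross e and also by the second edge g across (a, b), three in all.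
`GoodChord` therefore demands, when g ≠ e, that one of the crossings of e be spent on an edge other
than these. `GoodChord.exists_split` shows that the condition passes to both sides and that at most
two edges cross two sides of the triangle. Then a, b, c and one endpoint of each such edge form a
central bag of size at most five (`HasDecomp.triangle`), reached from the root bags of the sides by
swapping endpoints one at a time (`HasDecomp.exchange`). The recursion starts from an uncrossed
chord enclosing all vertices.

Tightness: a clique lies in a single bag (`TreeDecomposition.exists_subset_bag`), and five explicit
points on a circle draw the complete graph. -/

/-! ### Joining trees and tree decompositions -/

open SimpleGraph in
/-- Joining two finite trees by an edge yields a tree. -/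
theorem isTree_sum_sup_edge {ι κ : Type*} [Finite ι] [Finite κ] {S : SimpleGraph ι}
    {T : SimpleGraph κ} (hS : S.IsTree) (hT : T.IsTree) (i : ι) (j : κ) :
    (S.sum T ⊔ edge (.inl i) (.inr j)).IsTree := by
  classical
  rw [isTree_iff_connected_and_card]
  refine ⟨hS.connected.sum_sup_edge hT.connected, ?_⟩
  have h1 := (isTree_iff_connected_and_card.1 hS).2
  have h2 := (isTree_iff_connected_and_card.1 hT).2
  have h3 : Nat.card (S.sum T).edgeSet = Nat.card S.edgeSet + Nat.card T.edgeSet := by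
    rw [Nat.card_congr edgeSetSumEquiv, Nat.card_sum]
  have h4 : (S.sum T ⊔ edge (.inl i) (.inr j)).edgeSet
      = insert s(.inl i, .inr j) (S.sum T).edgeSet := by
    rw [edgeSet_sup, edgeSet_edge_of_ne (by simp), Set.union_comm, Set.insert_eq]
  have h5 : s(.inl i, .inr j) ∉ (S.sum T).edgeSet := by simp
  rw [h4, Nat.card_coe_set_eq, Set.ncard_insert_of_notMem h5, ← Nat.card_coe_set_eq, h3,
    Nat.card_sum]
  omega

open SimpleGraph in
/-- Subsets of two graphs that induce preconnected subgraphs do so in the graph obtained by joining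
`i` and `j`, provided that they contain `i` and `j` if neither is empty. -/
theorem preconnected_induce_sum_sup_edge {ι κ : Type*} {S : SimpleGraph ι} {T : SimpleGraph κ}
    {i : ι} {j : κ} {A : Set (ι ⊕ κ)}
    (hS : (S.induce {x | .inl x ∈ A}).Preconnected) (hT : (T.induce {y | .inr y ∈ A}).Preconnected)
    (hA : ∀ x y, .inl x ∈ A → .inr y ∈ A → .inl i ∈ A ∧ .inr j ∈ A) :
    ((S.sum T ⊔ edge (.inl i) (.inr j)).induce A).Preconnected := by
  let f : S.induce {x | .inl x ∈ A} →g (S.sum T ⊔ edge (.inl i) (.inr j)).induce A :=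
    ⟨fun x => ⟨.inl x.1, x.2⟩, fun {x y} h => Or.inl (by simpa using h)⟩
  let g : T.induce {x | .inr x ∈ A} →g (S.sum T ⊔ edge (.inl i) (.inr j)).induce A :=
    ⟨fun x => ⟨.inr x.1, x.2⟩, fun {x y} h => Or.inl (by simpa using h)⟩
  have key : ∀ x y (hx : .inl x ∈ A) (hy : .inr y ∈ A),
      ((S.sum T ⊔ edge (.inl i) (.inr j)).induce A).Reachable ⟨.inl x, hx⟩ ⟨.inr y, hy⟩ := by
    intro x y hx hy
    obtain ⟨hi, hj⟩ := hA x y hx hy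
    have h1 := (hS ⟨x, hx⟩ ⟨i, hi⟩).map f
    have h2 := (hT ⟨j, hj⟩ ⟨y, hy⟩).map g
    have h3 : ((S.sum T ⊔ edge (.inl i) (.inr j)).induce A).Adj ⟨.inl i, hi⟩ ⟨.inr j, hj⟩ :=
      Or.inr (by simp [edge_adj])
    exact (h1.trans h3.reachable).trans h2
  rintro ⟨x | x, hx⟩ ⟨y | y, hy⟩
  · exact (hS ⟨x, hx⟩ ⟨y, hy⟩).map f
  · exact key x y hx hy
  · exact (key y x hy hx).symm
  · exact (hT ⟨x, hx⟩ ⟨y, hy⟩).map g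

/-- There is a tree decomposition of the vertex set `W` with bags of size at most `k` that has the
bag `B` and covers the pairs in `R`. -/
def HasDecomp {α : Type u} (k : ℕ) (W : Set α) (R : α → α → Prop) (B : Finset α) : Prop :=
  ∃ (ι : Type) (_ : Fintype ι) (T : SimpleGraph ι) (bag : ι → Finset α) (r : ι),
    T.IsTree ∧ bag r = B ∧ (∀ i, (bag i).card ≤ k) ∧ (∀ x, x ∈ W ↔ ∃ i, x ∈ bag i) ∧
    (∀ x, (T.induce {i | x ∈ bag i}).Preconnected) ∧
    ∀ x y, R x y → ∃ i, x ∈ bag i ∧ y ∈ bag i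

namespace HasDecomp

variable {α : Type u} {k : ℕ} {W W₁ W₂ : Set α} {R R' R₁ R₂ : α → α → Prop} {B B₁ B₂ : Finset α}

theorem mono (h : HasDecomp k W R B) (hR : ∀ x y, R' x y → R x y) : HasDecomp k W R' B := by
  obtain ⟨ι, hι, T, bag, r, h1, h2, h3, h4, h5, h6⟩ := h
  exact ⟨ι, hι, T, bag, r, h1, h2, h3, h4, h5, fun x y h => h6 x y (hR x y h)⟩

theorem single (hB : B.card ≤ k) : HasDecomp k (B : Set α) (fun x y => x ∈ B ∧ y ∈ B) B :=
  ⟨Unit, inferInstance, ⊥, fun _ => B, (), SimpleGraph.IsTree.of_subsingleton, rfl, fun _ => hB,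
    fun x => by simp, fun x => SimpleGraph.Preconnected.of_subsingleton, fun x y h => ⟨(), h⟩⟩

theorem root_subset (h : HasDecomp k W R B) : (B : Set α) ⊆ W := by
  obtain ⟨ι, hι, T, bag, r, h1, h2, h3, h4, h5, h6⟩ := h
  exact fun x hx => (h4 x).2 ⟨r, h2 ▸ hx⟩

/-- Two decompositions whose vertex sets meet only in their root bags can be joined. -/
theorem glue (h₁ : HasDecomp k W₁ R₁ B₁) (h₂ : HasDecomp k W₂ R₂ B₂)
    (hW : ∀ x ∈ W₁, x ∈ W₂ → x ∈ B₁ ∧ x ∈ B₂) :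
    HasDecomp k (W₁ ∪ W₂) (fun x y => R₁ x y ∨ R₂ x y) B₁ := by
  obtain ⟨ι, _, S, bag, r, h1, h2, h3, h4, h5, h6⟩ := h₁
  obtain ⟨κ, _, T, bag', r', h1', h2', h3', h4', h5', h6'⟩ := h₂
  refine ⟨ι ⊕ κ, inferInstance, S.sum T ⊔ SimpleGraph.edge (.inl r) (.inr r'), Sum.elim bag bag',
    .inl r, isTree_sum_sup_edge h1 h1' r r', h2, ?_, ?_, ?_, ?_⟩
  · rintro (i | i)
    exacts [h3 i, h3' i]
  · intro x
    simp [h4, h4']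
  · intro x
    refine preconnected_induce_sum_sup_edge (h5 x) (h5' x) fun i j hi hj => ?_
    have := hW x ((h4 x).2 ⟨i, hi⟩) ((h4' x).2 ⟨j, hj⟩)
    simpa [h2, h2'] using this
  · rintro x y (h | h)
    · obtain ⟨i, hi⟩ := h6 x y h
      exact ⟨.inl i, hi⟩
    · obtain ⟨i, hi⟩ := h6' x y h
      exact ⟨.inr i, hi⟩

/-- A decomposition can be extended by a new root bag. -/
theorem extend (h : HasDecomp k W R B) (hB : B₁.card ≤ k) (hW : ∀ x ∈ B₁, x ∈ W → x ∈ B) :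
    HasDecomp k (B₁ ∪ W) (fun x y => (x ∈ B₁ ∧ y ∈ B₁) ∨ R x y) B₁ :=
  (single hB).glue h fun x h1 h2 => ⟨h1, hW x h1 h2⟩

theorem congr_set (h : HasDecomp k W R B) (hW : W = W₁) : HasDecomp k W₁ R B := hW ▸ h

/-- A decomposition that covers all vertices and edges of a graph, placed injectively in `α`,
bounds the treewidth. -/
theorem treewidth_le {V : Type*} [Finite V] {G : SimpleGraph V} (p : V ↪ α)
    (h : HasDecomp (k + 1) W R B) (hW : ∀ v, p v ∈ W)
    (hR : ∀ v w, G.Adj v w → R (p v) (p w) ∨ R (p w) (p v)) :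
    treewidth G ≤ k := by
  classical
  obtain ⟨ι, _, T, bag, r, h1, h2, h3, h4, h5, h6⟩ := h
  let D : TreeDecomposition G :=
    { ι := ι
      tree := T
      isTree := h1
      bag := fun i => (bag i).preimage p p.injective.injOn
      vertex_mem := fun v => by simpa using (h4 _).1 (hW v)
      edge_mem := fun v w hvw => by
        rcases hR v w hvw with h | h
        · simpa using h6 _ _ h
        · simpa [and_comm] using h6 _ _ h
      subtree := fun v => by
        obtain ⟨i, hi⟩ := (h4 _).1 (hW v)
        have : Nonempty {i | v ∈ (bag i).preimage p p.injective.injOn} := ⟨⟨i, by simpa using hi⟩⟩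
        refine ⟨?_⟩
        rw [show {i | v ∈ (bag i).preimage p p.injective.injOn} = {i | p v ∈ bag i} by ext; simp]
        exact h5 (p v) }
  refine ((isLeast_treewidth G).2 ⟨D, rfl⟩).trans ?_
  have : (Finset.univ.sup fun i => (D.bag i).card) ≤ k + 1 := by
    refine Finset.sup_le fun i _ => le_trans ?_ (h3 i)
    exact Finset.card_le_card_of_injOn p (fun x hx => by simpa [D] using hx) p.injective.injOn
  simp only [TreeDecomposition.width]
  omega

end HasDecomp

/-! ### Chords and their crossings -/

/-- Two chords `p` and `q`, given by their endpoints in increasing order, interleave. -/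
def Interleave (p q : ℕ × ℕ) : Prop :=
  (p.1 < q.1 ∧ q.1 < p.2 ∧ p.2 < q.2) ∨ (q.1 < p.1 ∧ p.1 < q.2 ∧ q.2 < p.2)

/-- The edges of `H`, given by their endpoints in increasing order, that interleave with `p`. -/
def crossingEdges (H : SimpleGraph ℕ) (p : ℕ × ℕ) : Set (ℕ × ℕ) :=
  {q | q.1 < q.2 ∧ H.Adj q.1 q.2 ∧ Interleave p q}

/-- At most two edges of `H` cross the chord `(a, b)`, and, if there are two, then one of them is
crossed by an edge that is not strictly on the inner side of the chord. -/
def GoodChord (H : SimpleGraph ℕ) (a b : ℕ) : Prop :=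
  crossingEdges H (a, b) = ∅ ∨ ∃ e ∈ crossingEdges H (a, b), ∃ g,
    crossingEdges H (a, b) ⊆ {e, g} ∧
      (g = e ∨ ∃ h ∈ crossingEdges H e, ¬(a ≤ h.1 ∧ h.2 ≤ b) ∨ h = (a, b))

theorem GoodChord.exists_subset_pair {H : SimpleGraph ℕ} {a b : ℕ} (h : GoodChord H a b) :
    ∃ e g, crossingEdges H (a, b) ⊆ {e, g} := by
  rcases h with h | ⟨e, -, g, h, -⟩
  · exact ⟨(a, b), (a, b), by simp [h]⟩
  · exact ⟨e, g, h⟩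

/-- Only `g` may lack an outside crossing. Any other crossing edge can play the distinguished role;
if there is none, `g` is the only possible crossing edge. -/
theorem goodChord_of_subset {H : SimpleGraph ℕ} {a b : ℕ} {z g : ℕ × ℕ}
    (h : crossingEdges H (a, b) ⊆ {z, g})
    (ho : ∀ q ∈ crossingEdges H (a, b), q = g ∨
      ∃ o ∈ crossingEdges H q, ¬(a ≤ o.1 ∧ o.2 ≤ b) ∨ o = (a, b)) : GoodChord H a b := by
  by_cases hq : ∃ q ∈ crossingEdges H (a, b), q ≠ g
  · obtain ⟨q, hq, hne⟩ := hq
    obtain rfl : q = z := (h hq).resolve_right hne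
    exact Or.inr ⟨q, hq, g, h, Or.inr ((ho q hq).resolve_left hne)⟩
  · push Not at hq
    by_cases hg : g ∈ crossingEdges H (a, b)
    · exact Or.inr ⟨g, hg, g, fun q hq' => by simp [hq q hq'], Or.inl rfl⟩
    · exact Or.inl (Set.eq_empty_of_forall_notMem fun q hq' => hg (hq q hq' ▸ hq'))

theorem exists_subset_pair_of_encard_le_two {α : Type*} [Nonempty α] {S : Set α}
    (h : S.encard ≤ 2) : ∃ a b, S ⊆ {a, b} := by
  by_cases h1 : S.encard ≤ 1
  · obtain rfl | ⟨a, rfl⟩ := Set.encard_le_one_iff_eq.1 h1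
    · exact ⟨Classical.arbitrary α, Classical.arbitrary α, by simp⟩
    · exact ⟨a, a, by simp⟩
  · have h2 : S.encard = 2 := le_antisymm h (by
      have := Order.add_one_le_of_lt (not_le.1 h1)
      rwa [one_add_one_eq_two] at this)
    obtain ⟨a, b, -, rfl⟩ := Set.encard_eq_two.1 h2
    exact ⟨a, b, le_rfl⟩

theorem exists_subset_singleton_of_encard_le_two {α : Type*} {S Z : Set α}
    (h : S.encard ≤ 2) (hZ : Z ⊆ S) {o : α} (ho : o ∈ S) (hoZ : o ∉ Z) : ∃ a, Z ⊆ {a} := by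
  have : Nonempty α := ⟨o⟩
  obtain ⟨a, b, hab⟩ := exists_subset_pair_of_encard_le_two h
  rcases hab ho with rfl | rfl
  · exact ⟨b, fun z hz => (hab (hZ hz)).resolve_left fun h => hoZ (h ▸ hz)⟩
  · exact ⟨a, fun z hz => (hab (hZ hz)).resolve_right fun h => hoZ (h ▸ hz)⟩

/-! ### Splitting a good chord -/

/-- The edges of `H` that cross two sides of the triangle `a < c < b`. -/
def throughEdges (H : SimpleGraph ℕ) (a c b : ℕ) : Set (ℕ × ℕ) :=
  {q | q ∈ crossingEdges H (a, b) ∧ q.1 ≠ c ∧ q.2 ≠ c ∨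
    q.1 < q.2 ∧ H.Adj q.1 q.2 ∧ a < q.1 ∧ q.1 < c ∧ c < q.2 ∧ q.2 < b}

/-- The endpoint of `e` that lies between `a` and `b`. -/
def innerEnd (a b : ℕ) (e : ℕ × ℕ) : ℕ := if a < e.1 ∧ e.1 < b then e.1 else e.2

/-- Take c as the farthest neighbor of a before b. An edge crossing (c, b) cannot leave [a, b], nor
start at a by maximality, so it also crosses (a, c). Thus the at most two edges crossing (a, c)
account for everything, and (a, c) itself is their outside crossing. -/
theorem GoodChord.exists_split_of_empty {H : SimpleGraph ℕ}
    (hH : ∀ p : ℕ × ℕ, p.1 < p.2 → H.Adj p.1 p.2 → (crossingEdges H p).encard ≤ 2) {a b : ℕ}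
    (hab : a + 1 < b) (h : crossingEdges H (a, b) = ∅) :
    ∃ c, a < c ∧ c < b ∧ GoodChord H a c ∧ GoodChord H c b ∧
      ∃ t₁ t₂, throughEdges H a c b ⊆ {t₁, t₂} := by
  classical
  -- The default a + 1 keeps `S` nonempty; if it is chosen, no edge can cross (a, c).
  let S := (Finset.Ioo a b).filter fun c => c = a + 1 ∨ H.Adj a c
  have hS : S.Nonempty := ⟨a + 1, by simp [S]; omega⟩
  obtain ⟨c, hc, hmax⟩ := S.exists_max_image id hS
  simp only [S, Finset.mem_filter, Finset.mem_Ioo, id] at hc hmax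
  obtain ⟨⟨hac, hcb⟩, hadj⟩ := hc
  have hX : ∀ q : ℕ × ℕ, q.1 < q.2 → H.Adj q.1 q.2 → ¬ Interleave (a, b) q := fun q h1 h2 h3 => by
    have : q ∈ crossingEdges H (a, b) := ⟨h1, h2, h3⟩
    simp [h] at this
  have hcb' : crossingEdges H (c, b) ⊆ crossingEdges H (a, c) := by
    rintro ⟨x, y⟩ ⟨h1, h2, h3⟩
    have h4 := hX _ h1 h2
    refine ⟨h1, h2, ?_⟩
    have h5 : x = a → y < b → y ≤ c := fun hx hy => by
      subst hx
      exact hmax y ⟨⟨h1, hy⟩, Or.inr h2⟩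
    simp only [Interleave] at *
    omega
  obtain ⟨z₁, z₂, hz⟩ : ∃ z₁ z₂, crossingEdges H (a, c) ⊆ {z₁, z₂} := by
    rcases hadj with rfl | hadj
    · refine ⟨(a, b), (a, b), ?_⟩
      rintro ⟨x, y⟩ ⟨h1, h2, h3⟩
      simp only [Interleave] at h3
      omega
    · exact exists_subset_pair_of_encard_le_two (hH (a, c) hac hadj)
  have hself : ∀ q ∈ crossingEdges H (a, c), (a, c) ∈ crossingEdges H q := by
    rintro ⟨x, y⟩ ⟨h1, h2, h3⟩
    refine ⟨hac, ?_, h3.symm⟩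
    rcases hadj with rfl | hadj
    · simp only [Interleave] at h3
      omega
    · exact hadj
  refine ⟨c, hac, hcb, goodChord_of_subset hz fun q hq => Or.inr ⟨(a, c), hself q hq, Or.inr rfl⟩,
    goodChord_of_subset (hcb'.trans hz) fun q hq => Or.inr ⟨(a, c), hself q (hcb' hq), Or.inl ?_⟩,
    z₁, z₂, fun q hq => hz ?_⟩
  · simp only [not_and, not_le]
    omega
  · rcases hq with hq | ⟨h1, h2, h3⟩
    · simp [h] at hq
    · refine ⟨h1, h2, ?_⟩
      simp only [Interleave]
      omega

theorem GoodChord.exists_split {H : SimpleGraph ℕ}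
    (hH : ∀ p : ℕ × ℕ, p.1 < p.2 → H.Adj p.1 p.2 → (crossingEdges H p).encard ≤ 2) {a b : ℕ}
    (hab : a + 1 < b) (h : GoodChord H a b) :
    ∃ c, a < c ∧ c < b ∧ GoodChord H a c ∧ GoodChord H c b ∧
      ∃ t₁ t₂, throughEdges H a c b ⊆ {t₁, t₂} := by
  rcases h with h | ⟨e, he, g, hX, hg⟩
  · exact GoodChord.exists_split_of_empty hH hab h
  let c := innerEnd a b e
  have hc : a < c ∧ c < b ∧ (e.1 = c ∧ b < e.2 ∨ e.2 = c ∧ e.1 < a) := by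
    obtain ⟨h1, h2, h3⟩ := he
    simp only [c, innerEnd]
    simp only [Interleave] at h3
    split_ifs <;> omega
  clear_value c
  obtain ⟨hac, hcb, hec⟩ := hc
  -- From c, `e` leaves [a, b], so it crosses every other edge that joins the two sides of c within
  -- [a, b].
  let Z : Set (ℕ × ℕ) := {q | q.1 < q.2 ∧ H.Adj q.1 q.2 ∧ a ≤ q.1 ∧ q.1 < c ∧ c < q.2 ∧ q.2 ≤ b ∧
    q ≠ (a, b)}
  have hZ : Z ⊆ crossingEdges H e := by
    rintro q ⟨h1, h2, h3⟩
    refine ⟨h1, h2, ?_⟩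
    simp only [Interleave]
    omega
  have heZ : ∀ q ∈ Z, e ∈ crossingEdges H q := fun q hq =>
    ⟨he.1, he.2.1, (hZ hq).2.2.symm⟩
  -- The pair will contain all edges crossing a new side, and all through edges. Only `w` may lie
  -- outside `Z`; members of `Z` have `e` as their outside crossing.
  obtain ⟨z, w, hzw⟩ : ∃ z w, ∀ q, q ∈ Z ∨ q ∈ crossingEdges H (a, b) ∧ q ≠ e →
      (q = z ∨ q = w) ∧ (q ∈ Z ∨ q = w) := by
    have hcard := hH e he.1 he.2.1
    rcases hg with rfl | ⟨o, ho, ho'⟩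
    · obtain ⟨z, w, hzw⟩ := exists_subset_pair_of_encard_le_two hcard
      refine ⟨z, w, ?_⟩
      rintro q (hq | ⟨hq, hne⟩)
      · exact ⟨hzw (hZ hq), Or.inl hq⟩
      · exact absurd (hX hq) (by simpa using hne)
    -- `o` takes one of the two crossings of `e`, so `Z` has at most one member and there is room
    -- for `g`.
    · have hoZ : o ∉ Z := by
        rintro ⟨h1, h2, h3, h4, h5, h6, h7⟩
        rcases ho' with ho' | ho'
        exacts [ho' ⟨h3, h6⟩, h7 ho']
      obtain ⟨z, hz⟩ := exists_subset_singleton_of_encard_le_two hcard hZ ho hoZ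
      refine ⟨z, g, ?_⟩
      rintro q (hq | ⟨hq, hne⟩)
      · exact ⟨Or.inl (hz hq), Or.inl hq⟩
      · have := (hX hq).resolve_left hne
        exact ⟨Or.inr this, Or.inr this⟩
  have side : ∀ l r, a ≤ l → r ≤ b → (l = c ∨ r = c) → l < r →
      (∀ q ∈ crossingEdges H (l, r), q ∈ Z ∨ q ∈ crossingEdges H (a, b) ∧ q ≠ e) →
      GoodChord H l r := by
    intro l r hal hrb hlr hlt hq
    refine goodChord_of_subset (z := z) (g := w) (fun q h => (hzw q (hq q h)).1) fun q h => ?_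
    refine (hzw q (hq q h)).2.symm.imp_right fun h => ⟨e, heZ q h, Or.inl ?_⟩
    omega
  refine ⟨c, hac, hcb, side a c le_rfl hcb.le (Or.inr rfl) hac ?_,
    side c b hac.le le_rfl (Or.inl rfl) hcb ?_, z, w, fun q hq => (hzw q ?_).1⟩
  · rintro ⟨x, y⟩ ⟨h1, h2, h3⟩
    simp only [Interleave, Z, crossingEdges, Set.mem_ofPred_eq, h1, h2, true_and, ne_eq,
      Prod.ext_iff] at h3 ⊢
    clear hg hX hzw
    omega
  · rintro ⟨x, y⟩ ⟨h1, h2, h3⟩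
    simp only [Interleave, Z, crossingEdges, Set.mem_ofPred_eq, h1, h2, true_and, ne_eq,
      Prod.ext_iff] at h3 ⊢
    clear hg hX hzw
    omega
  · rcases hq with ⟨h1, h2, h3⟩ | ⟨h1, h2, h3, h4, h5, h6⟩
    · refine Or.inr ⟨h1, ?_⟩
      rintro rfl
      omega
    · refine Or.inl ⟨h1, h2, h3.le, h4, h5, h6.le, ?_⟩
      rintro rfl
      simp at h3

/-! ### Combining decompositions across a triangle -/

theorem Set.eq_empty_or_eq_pair_of_subset_pair {α : Type*} {S : Set α} {a b : α} (h : S ⊆ {a, b}) :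
    S = ∅ ∨ ∃ a b, S = {a, b} := by
  rcases Set.subset_pair_iff_eq.1 h with h | h | h | h
  · exact Or.inl h
  · exact Or.inr ⟨a, a, by simp [h]⟩
  · exact Or.inr ⟨b, b, by simp [h]⟩
  · exact Or.inr ⟨a, b, h⟩

theorem innerEnd_mem {H : SimpleGraph ℕ} {a b : ℕ} {e : ℕ × ℕ} (he : e ∈ crossingEdges H (a, b)) :
    a < innerEnd a b e ∧ innerEnd a b e < b := by
  obtain ⟨h1, h2, h3⟩ := he
  simp only [Interleave] at h3
  simp only [innerEnd]
  split_ifs <;> omega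

theorem eq_innerEnd_of_mem {H : SimpleGraph ℕ} {a b x : ℕ} {e : ℕ × ℕ}
    (he : e ∈ crossingEdges H (a, b)) (hx : x = e.1 ∨ x = e.2) (hax : a ≤ x) (hxb : x ≤ b) :
    x = innerEnd a b e := by
  obtain ⟨h1, h2, h3⟩ := he
  simp only [Interleave] at h3
  simp only [innerEnd]
  split_ifs <;> omega

theorem eq_innerEnd_or {H : SimpleGraph ℕ} {a b x : ℕ} {e : ℕ × ℕ}
    (he : e ∈ crossingEdges H (a, b)) (hx : x = e.1 ∨ x = e.2) (hxab : ¬(a ≤ x ∧ x ≤ b)) :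
    (x = e.1 ∧ innerEnd a b e = e.2) ∨ (x = e.2 ∧ innerEnd a b e = e.1) := by
  obtain ⟨h1, h2, h3⟩ := he
  simp only [Interleave] at h3
  simp only [innerEnd]
  split_ifs <;> omega

/-- The inner endpoints of the edges crossing a chord can be exchanged for the endpoints selected
by `ρ` by adding bags of size at most five on top of a decomposition of the inner side. -/
theorem HasDecomp.exchange {H : SimpleGraph ℕ} {l r : ℕ} {ρ : ℕ × ℕ → ℕ}
    (hρ : ∀ e ∈ crossingEdges H (l, r), ρ e = e.1 ∨ ρ e = e.2)
    (hX : ∃ p q, crossingEdges H (l, r) ⊆ {p, q}) {C : Finset ℕ}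
    (hC : ∀ x, x ∈ C ↔ x = l ∨ x = r ∨ ∃ e ∈ crossingEdges H (l, r), innerEnd l r e = x)
    (h : HasDecomp 5 (Set.Icc l r) (fun x y => x < y ∧ H.Adj x y ∧ l ≤ x ∧ y ≤ r) C) :
    ∃ B : Finset ℕ, (∀ x, x ∈ B ↔ x = l ∨ x = r ∨ ∃ e ∈ crossingEdges H (l, r), ρ e = x) ∧
      HasDecomp 5 (Set.Icc l r ∪ B) (fun x y => x < y ∧ H.Adj x y ∧ (l ≤ x ∧ y ≤ r ∨
        (x, y) ∈ crossingEdges H (l, r) ∧ ¬(l ≤ ρ (x, y) ∧ ρ (x, y) ≤ r))) B := by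
  obtain ⟨p, q, hX⟩ := hX
  rcases Set.eq_empty_or_eq_pair_of_subset_pair hX with hX | ⟨p, q, hX⟩
  · refine ⟨C, by simpa [hX] using hC, (h.congr_set ?_).mono ?_⟩
    · exact (Set.union_eq_self_of_subset_right h.root_subset).symm
    · rintro x y ⟨h1, h2, h3 | h3⟩
      · exact ⟨h1, h2, h3⟩
      · simp [hX] at h3
  have hp : p ∈ crossingEdges H (l, r) := by simp [hX]
  have hq : q ∈ crossingEdges H (l, r) := by simp [hX]
  have hip := innerEnd_mem hp
  have hiq := innerEnd_mem hq
  have hρp := eq_innerEnd_of_mem hp (hρ p hp)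
  have hρq := eq_innerEnd_of_mem hq (hρ q hq)
  have hρp' := eq_innerEnd_or hp (hρ p hp)
  have hρq' := eq_innerEnd_or hq (hρ q hq)
  have hC' : ∀ x, x ∈ C ↔ x = l ∨ x = r ∨ x = innerEnd l r p ∨ x = innerEnd l r q := by
    intro x
    rw [hC, hX]
    simp [eq_comm]
  set i := innerEnd l r p
  set j := innerEnd l r q
  -- Swap one endpoint at a time: `ρ q` enters before `j` leaves, then `ρ p` enters before `i`
  -- leaves. Each edge whose selected end is outside is covered by the bag containing both its ends.
  have h2 := h.extend (B₁ := {l, r, i, ρ q, j}) Finset.card_le_five (by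
    intro x hx hx'
    simp only [Finset.mem_insert, Finset.mem_singleton, Set.mem_Icc, hC'] at *
    grind)
  have h1 := h2.extend (B₁ := {l, r, ρ p, i, ρ q}) Finset.card_le_five (by
    intro x hx hx'
    simp only [Finset.mem_insert, Finset.mem_singleton, Set.mem_Icc, Set.mem_union,
      Finset.mem_coe] at *
    grind)
  have h0 := h1.extend (B₁ := {l, r, ρ p, ρ q}) (Finset.card_le_four.trans (by norm_num)) (by
    intro x hx hx'
    simp only [Finset.mem_insert, Finset.mem_singleton] at *
    grind)
  refine ⟨{l, r, ρ p, ρ q}, ?_, (h0.congr_set ?_).mono ?_⟩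
  · intro x
    rw [hX]
    simp [eq_comm]
  · ext x
    simp only [Finset.mem_insert, Finset.mem_singleton, Set.mem_Icc, Set.mem_union,
      Finset.mem_coe]
    grind
  · rintro x y ⟨hxy, hadj, h | ⟨h, h'⟩⟩
    · exact Or.inr (Or.inr (Or.inr ⟨hxy, hadj, h⟩))
    · rw [hX] at h
      rcases h with h | h <;> subst h
      · refine Or.inr (Or.inl ?_)
        simp only [Finset.mem_insert, Finset.mem_singleton]
        grind
      · refine Or.inr (Or.inr (Or.inl ?_))
        simp only [Finset.mem_insert, Finset.mem_singleton]
        grind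

/-- Decompositions of the inner sides of the chords `(a, c)` and `(c, b)` can be combined if at most
two edges cross two sides of the triangle `a < c < b`. -/
theorem HasDecomp.triangle {H : SimpleGraph ℕ} {a c b : ℕ} (hac : a < c) (hcb : c < b)
    (hX₁ : ∃ p q, crossingEdges H (a, c) ⊆ {p, q}) (hX₂ : ∃ p q, crossingEdges H (c, b) ⊆ {p, q})
    (hX : ∃ p q, crossingEdges H (a, b) ⊆ {p, q}) (hT : ∃ p q, throughEdges H a c b ⊆ {p, q})
    {C₁ C₂ : Finset ℕ}
    (hC₁ : ∀ x, x ∈ C₁ ↔ x = a ∨ x = c ∨ ∃ e ∈ crossingEdges H (a, c), innerEnd a c e = x)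
    (hC₂ : ∀ x, x ∈ C₂ ↔ x = c ∨ x = b ∨ ∃ e ∈ crossingEdges H (c, b), innerEnd c b e = x)
    (h₁ : HasDecomp 5 (Set.Icc a c) (fun x y => x < y ∧ H.Adj x y ∧ a ≤ x ∧ y ≤ c) C₁)
    (h₂ : HasDecomp 5 (Set.Icc c b) (fun x y => x < y ∧ H.Adj x y ∧ c ≤ x ∧ y ≤ b) C₂) :
    ∃ C : Finset ℕ,
      (∀ x, x ∈ C ↔ x = a ∨ x = b ∨ ∃ e ∈ crossingEdges H (a, b), innerEnd a b e = x) ∧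
      HasDecomp 5 (Set.Icc a b) (fun x y => x < y ∧ H.Adj x y ∧ a ≤ x ∧ y ≤ b) C := by
  -- An edge from a or to b is represented by that corner, which is in the central bag anyway. An
  -- edge running between the open sides is represented by its smaller end, so both side bags agree
  -- on it.
  let ρ : ℕ × ℕ → ℕ := fun e => if e.1 = a then a else if e.2 = b then b else innerEnd a b e
  have hρ : ∀ e, ρ e = e.1 ∨ ρ e = e.2 := by
    intro e
    simp only [ρ, innerEnd]
    split_ifs <;> omega
  obtain ⟨B₁, hB₁, h₁⟩ := h₁.exchange (ρ := ρ) (fun e _ => hρ e) hX₁ hC₁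
  obtain ⟨B₂, hB₂, h₂⟩ := h₂.exchange (ρ := ρ) (fun e _ => hρ e) hX₂ hC₂
  -- The central bag: three corners and at most two representatives give the bound five.
  obtain ⟨B, hB, hB5⟩ : ∃ B : Finset ℕ, (∀ x, x ∈ B ↔ x = a ∨ x = c ∨ x = b ∨
      ∃ e ∈ throughEdges H a c b, innerEnd a b e = x) ∧ B.card ≤ 5 := by
    obtain ⟨p, q, hT⟩ := hT
    rcases Set.eq_empty_or_eq_pair_of_subset_pair hT with hT | ⟨p, q, hT⟩
    · exact ⟨{a, c, b}, by simp [hT], Finset.card_le_three.trans (by norm_num)⟩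
    · exact ⟨{a, c, b, innerEnd a b p, innerEnd a b q}, by simp [hT, eq_comm],
        Finset.card_le_five⟩
  obtain ⟨C, hC, hC5⟩ : ∃ C : Finset ℕ, (∀ x, x ∈ C ↔ x = a ∨ x = b ∨
      ∃ e ∈ crossingEdges H (a, b), innerEnd a b e = x) ∧ C.card ≤ 5 := by
    obtain ⟨p, q, hX⟩ := hX
    rcases Set.eq_empty_or_eq_pair_of_subset_pair hX with hX | ⟨p, q, hX⟩
    · exact ⟨{a, b}, by simp [hX], Finset.card_le_two.trans (by norm_num)⟩
    · exact ⟨{a, b, innerEnd a b p, innerEnd a b q}, by simp [hX, eq_comm],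
        Finset.card_le_four.trans (by norm_num)⟩
  have hthrough : ∀ e ∈ throughEdges H a c b,
      (a < innerEnd a b e ∧ innerEnd a b e < b) ∧ ρ e = innerEnd a b e ∧
      (innerEnd a b e ≤ c → e ∈ crossingEdges H (a, c)) ∧
      (c ≤ innerEnd a b e → e ∈ crossingEdges H (c, b)) := by
    rintro ⟨x, y⟩ (⟨⟨h1, h2, h3⟩, h4⟩ | ⟨h1, h2, h3⟩)
    · simp only [crossingEdges, Set.mem_ofPred_eq, h1, h2, true_and]
      simp only [Interleave, innerEnd, ρ] at h1 h3 h4 ⊢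
      split_ifs <;> omega
    · simp only [crossingEdges, Set.mem_ofPred_eq, h1, h2, true_and]
      simp only [Interleave, innerEnd, ρ] at h1 h3 ⊢
      split_ifs <;> omega
  have hside₁ : ∀ e ∈ crossingEdges H (a, c), ρ e = b ∨ e ∈ throughEdges H a c b := by
    rintro ⟨x, y⟩ ⟨h1, h2, h3⟩
    simp only [crossingEdges, throughEdges, Set.mem_ofPred_eq, h1, h2, true_and]
    simp only [Interleave, ρ] at h1 h3 ⊢
    split_ifs <;> omega
  have hside₂ : ∀ e ∈ crossingEdges H (c, b), ρ e = a ∨ e ∈ throughEdges H a c b := by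
    rintro ⟨x, y⟩ ⟨h1, h2, h3⟩
    simp only [crossingEdges, throughEdges, Set.mem_ofPred_eq, h1, h2, true_and]
    simp only [Interleave, ρ] at h1 h3 ⊢
    split_ifs <;> omega
  have hBab : ∀ x ∈ B, a ≤ x ∧ x ≤ b := by
    intro x hx
    rcases (hB x).1 hx with rfl | rfl | rfl | ⟨e, he, rfl⟩
    · omega
    · omega
    · omega
    · have := hthrough e he
      omega
  have hBB₁ : ∀ x ∈ B₁, x ∈ B := by
    intro x hx
    rcases (hB₁ x).1 hx with rfl | rfl | ⟨e, he, rfl⟩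
    · simp [hB]
    · simp [hB]
    · rcases hside₁ e he with h | h
      · simp [hB, h]
      · exact (hB _).2 (Or.inr (Or.inr (Or.inr ⟨e, h, (hthrough e h).2.1.symm⟩)))
  have hBB₂ : ∀ x ∈ B₂, x ∈ B := by
    intro x hx
    rcases (hB₂ x).1 hx with rfl | rfl | ⟨e, he, rfl⟩
    · simp [hB]
    · simp [hB]
    · rcases hside₂ e he with h | h
      · simp [hB, h]
      · exact (hB _).2 (Or.inr (Or.inr (Or.inr ⟨e, h, (hthrough e h).2.1.symm⟩)))
  have hB₁B : ∀ x ∈ B, x ≤ c → x ∈ B₁ := by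
    intro x hx hxc
    rcases (hB x).1 hx with rfl | rfl | rfl | ⟨e, he, rfl⟩
    · simp [hB₁]
    · simp [hB₁]
    · omega
    · have := hthrough e he
      exact (hB₁ _).2 (Or.inr (Or.inr ⟨e, this.2.2.1 hxc, this.2.1⟩))
  have hB₂B : ∀ x ∈ B, c ≤ x → x ∈ B₂ := by
    intro x hx hxc
    rcases (hB x).1 hx with rfl | rfl | rfl | ⟨e, he, rfl⟩
    · omega
    · simp [hB₂]
    · simp [hB₂]
    · have := hthrough e he
      exact (hB₂ _).2 (Or.inr (Or.inr ⟨e, this.2.2.2 hxc, this.2.1⟩))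
  have hCB : ∀ x ∈ C, x ∈ B := by
    intro x hx
    rcases (hC x).1 hx with rfl | rfl | ⟨e, he, rfl⟩
    · simp [hB]
    · simp [hB]
    · rw [hB]
      by_cases hec : innerEnd a b e = c
      · exact Or.inr (Or.inl hec)
      · refine Or.inr (Or.inr (Or.inr ⟨e, Or.inl ⟨he, fun h => hec ?_, fun h => hec ?_⟩, rfl⟩))
        · rw [← eq_innerEnd_of_mem he (Or.inl rfl) (by omega) (by omega), h]
        · rw [← eq_innerEnd_of_mem he (Or.inr rfl) (by omega) (by omega), h]
  have h3 := (HasDecomp.single hB5).glue h₁ (by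
    rintro x hx (⟨-, hxc⟩ | hx')
    · exact ⟨hx, hB₁B x hx hxc⟩
    · exact ⟨hx, hx'⟩)
  have h4 := h3.glue h₂ (by
    rintro x hx (⟨hcx, -⟩ | hx')
    · rcases hx with hx | ⟨-, hxc⟩ | hx
      · exact ⟨hx, hB₂B x hx hcx⟩
      · obtain rfl : x = c := le_antisymm hxc hcx
        simp [hB, hB₂]
      · exact ⟨hBB₁ x hx, hB₂B x (hBB₁ x hx) hcx⟩
    · exact ⟨hBB₂ x hx', hx'⟩)
  have h5 := h4.extend hC5 fun x hx _ => hCB x hx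
  refine ⟨C, hC, (h5.congr_set ?_).mono ?_⟩
  · ext x
    simp only [Set.mem_union, Finset.mem_coe, Set.mem_Icc]
    have h6 := hCB x
    have h7 := hBB₁ x
    have h8 := hBB₂ x
    have h9 := hBab x
    by_cases hx : x ≤ c <;> grind
  · rintro x y ⟨hxy, hadj, hax, hyb⟩
    by_cases hyc : y ≤ c
    · exact Or.inr (Or.inl (Or.inr ⟨hxy, hadj, Or.inl ⟨hax, hyc⟩⟩))
    by_cases hcx : c ≤ x
    · exact Or.inr (Or.inr ⟨hxy, hadj, Or.inl ⟨hcx, hyb⟩⟩)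
    -- An edge passing over c is covered during an exchange: on the left side if it ends at b and
    -- does not start at a, on the right side if it ends before b. The edge (a, b) lies in the
    -- central bag.
    by_cases hyb' : y = b
    · by_cases hxa : x = a
      · exact Or.inr (Or.inl (Or.inl (by simp [hB, hxa, hyb'])))
      · refine Or.inr (Or.inl (Or.inr ⟨hxy, hadj, Or.inr ⟨⟨hxy, hadj, ?_⟩, ?_⟩⟩))
        · simp only [Interleave]
          omega
        · simp only [ρ, hxa, hyb', if_true, if_false]
          omega
    · refine Or.inr (Or.inr ⟨hxy, hadj, Or.inr ⟨⟨hxy, hadj, ?_⟩, ?_⟩⟩)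
      · simp only [Interleave]
        omega
      · simp only [ρ, innerEnd]
        split_ifs <;> omega

/-- The root bag is prescribed exactly, so that the two sides of the split chord meet the
requirements of `HasDecomp.triangle` in the induction on `b - a`. -/
theorem GoodChord.hasDecomp {H : SimpleGraph ℕ}
    (hH : ∀ p : ℕ × ℕ, p.1 < p.2 → H.Adj p.1 p.2 → (crossingEdges H p).encard ≤ 2) {a b : ℕ}
    (hab : a < b) (h : GoodChord H a b) :
    ∃ C : Finset ℕ,
      (∀ x, x ∈ C ↔ x = a ∨ x = b ∨ ∃ e ∈ crossingEdges H (a, b), innerEnd a b e = x) ∧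
      HasDecomp 5 (Set.Icc a b) (fun x y => x < y ∧ H.Adj x y ∧ a ≤ x ∧ y ≤ b) C := by
  induction hn : b - a using Nat.strong_induction_on generalizing a b with
  | _ n ih =>
    by_cases hab' : b = a + 1
    · subst hab'
      have hX : ∀ e, e ∉ crossingEdges H (a, a + 1) := fun e he => by
        have := innerEnd_mem he
        omega
      refine ⟨{a, a + 1}, by simp [hX], ((HasDecomp.single
        (Finset.card_le_two.trans (by norm_num))).congr_set ?_).mono ?_⟩
      · ext x
        simp only [Finset.coe_insert, Finset.coe_singleton, Set.mem_insert_iff,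
          Set.mem_singleton_iff, Set.mem_Icc]
        omega
      · rintro x y ⟨hxy, -, h1, h2⟩
        simp only [Finset.mem_insert, Finset.mem_singleton]
        omega
    · obtain ⟨c, hac, hcb, h₁, h₂, hT⟩ := h.exists_split hH (by omega)
      obtain ⟨C₁, hC₁, hd₁⟩ := ih (c - a) (by omega) hac h₁ rfl
      obtain ⟨C₂, hC₂, hd₂⟩ := ih (b - c) (by omega) hcb h₂ rfl
      exact HasDecomp.triangle hac hcb h₁.exists_subset_pair h₂.exists_subset_pair
        h.exists_subset_pair hT hC₁ hC₂ hd₁ hd₂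

/-- A graph placed injectively in the natural numbers in which every edge interleaves with at
most two others has treewidth at most four. -/
theorem treewidth_le_four_of_crossingEdges {V : Type u} [Finite V] {G : SimpleGraph V} (p : V ↪ ℕ)
    (hp : ∀ e : ℕ × ℕ, e.1 < e.2 → (G.map p).Adj e.1 e.2 →
      (crossingEdges (G.map p) e).encard ≤ 2) : treewidth G ≤ 4 := by
  obtain ⟨N, hN⟩ : ∃ N, ∀ v, p v ≤ N := by
    obtain ⟨N, hN⟩ := (Set.finite_range p).bddAbove
    exact ⟨N, fun v => hN ⟨v, rfl⟩⟩
  -- All positions lie in [0, N], so no edge has an end outside this chord. Numbers in the interval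
  -- that are not vertices disappear when bags are pulled back along `p`.
  have hX : crossingEdges (G.map p) (0, N + 1) = ∅ := by
    refine Set.eq_empty_of_forall_notMem ?_
    rintro ⟨x, y⟩ ⟨-, ⟨-, v, w, -, rfl, rfl⟩, h⟩
    have := hN w
    simp only [Interleave] at h
    omega
  obtain ⟨C, -, hC⟩ := GoodChord.hasDecomp hp N.succ_pos (Or.inl hX)
  refine hC.treewidth_le (k := 4) p (fun v => ⟨Nat.zero_le _, (hN v).trans N.le_succ⟩)
    fun v w hvw => ?_
  have hadj : (G.map p).Adj (p v) (p w) := by simpa using hvw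
  have hv := hN v
  have hw := hN w
  rcases lt_or_gt_of_ne hadj.ne with h | h
  · exact Or.inl ⟨h, hadj, Nat.zero_le _, by omega⟩
  · exact Or.inr ⟨h, hadj.symm, Nat.zero_le _, by omega⟩

/-! ### From circular drawings to interleaving chords -/

theorem exists_embedding_nat_of_injective {V : Type u} [Finite V] {θ : V → ℝ}
    (hθ : Function.Injective θ) : ∃ p : V ↪ ℕ, ∀ u v, p u < p v → θ u < θ v := by
  classical
  have := Fintype.ofFinite V
  let p : V → ℕ := fun v => (Finset.univ.filter fun w => θ w < θ v).card
  have hp : ∀ u v, θ u < θ v → p u < p v := by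
    intro u v h
    refine Finset.card_lt_card (Finset.ssubset_iff_of_subset ?_ |>.2 ⟨u, by simpa using h, by simp⟩)
    intro w hw
    simp only [Finset.mem_filter, Finset.mem_univ, true_and] at hw ⊢
    exact hw.trans h
  refine ⟨⟨p, fun u v h => ?_⟩, fun u v h => ?_⟩
  · by_contra hne
    rcases lt_or_gt_of_ne (hθ.ne hne) with h' | h'
    · exact (hp u v h').ne h
    · exact (hp v u h').ne' h
  · by_contra hle
    rcases (not_lt.1 hle).lt_or_eq with h' | h'
    · exact (hp v u h').not_gt h
    · exact h.ne (by rw [hθ h'])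

/-- Twice the signed area of the triangle spanned by the points of the unit circle with angles
`α`, `β` and `γ`. -/
noncomputable def circleArea (α β γ : ℝ) : ℝ :=
  Real.sin (β - α) + Real.sin (γ - β) - Real.sin (γ - α)

/-- The area factors as four times the product of the sines of the three half differences, all of
which lie strictly between 0 and π. -/
theorem circleArea_pos {α β γ : ℝ} (hαβ : α < β) (hβγ : β < γ) (hαγ : γ < α + 2 * Real.pi) :
    0 < circleArea α β γ := by
  have h : circleArea α β γ
      = 4 * Real.sin ((β - α) / 2) * Real.sin ((γ - β) / 2) * Real.sin ((γ - α) / 2) := by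
    set x := (β - α) / 2 with hx
    set y := (γ - β) / 2 with hy
    have h1 : β - α = 2 * x := by ring
    have h2 : γ - β = 2 * y := by ring
    have h3 : γ - α = 2 * (x + y) := by rw [hx, hy]; ring
    have h4 : (γ - α) / 2 = x + y := by rw [hx, hy]; ring
    rw [circleArea, h1, h2, h4, h3, Real.sin_two_mul, Real.sin_two_mul, Real.sin_two_mul,
      Real.sin_add, Real.cos_add]
    have hx1 := Real.sin_sq_add_cos_sq x
    have hy1 := Real.sin_sq_add_cos_sq y
    have hx2 : Real.cos x ^ 2 = 1 - Real.sin x ^ 2 := by linarith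
    have hy2 : Real.cos y ^ 2 = 1 - Real.sin y ^ 2 := by linarith
    linear_combination (-2 * Real.sin y * Real.cos y) * hx2 + (-2 * Real.sin x * Real.cos x) * hy2
  rw [h]
  have h1 := Real.sin_pos_of_pos_of_lt_pi (x := (β - α) / 2) (by linarith) (by linarith)
  have h2 := Real.sin_pos_of_pos_of_lt_pi (x := (γ - β) / 2) (by linarith) (by linarith)
  have h3 := Real.sin_pos_of_pos_of_lt_pi (x := (γ - α) / 2) (by linarith) (by linarith)
  positivity

/-- The chords between alternating points of a circle intersect. -/
theorem openSegment_inter_openSegment_nonempty {c : Plane} {r : ℝ} {α β γ δ : ℝ} {P Q R S : Plane}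
    (hαβ : α < β) (hβγ : β < γ) (hγδ : γ < δ) (hδ : δ < α + 2 * Real.pi)
    (hP : P 0 = c 0 + r * Real.cos α ∧ P 1 = c 1 + r * Real.sin α)
    (hQ : Q 0 = c 0 + r * Real.cos β ∧ Q 1 = c 1 + r * Real.sin β)
    (hR : R 0 = c 0 + r * Real.cos γ ∧ R 1 = c 1 + r * Real.sin γ)
    (hS : S 0 = c 0 + r * Real.cos δ ∧ S 1 = c 1 + r * Real.sin δ) :
    (openSegment ℝ P R ∩ openSegment ℝ Q S).Nonempty := by
  have h1 := circleArea_pos hαβ hβγ (by linarith)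
  have h2 := circleArea_pos hαβ (hβγ.trans hγδ) hδ
  have h3 := circleArea_pos (hαβ.trans hβγ) hγδ hδ
  have h4 := circleArea_pos hβγ hγδ (by linarith)
  -- For four planar points, [QRS]P + [PQS]R = [PRS]Q + [PQR]S with equal total weights, where [·]
  -- is the signed area. Normalizing gives one point on both chords.
  have hsum : circleArea β γ δ + circleArea α β δ = circleArea α γ δ + circleArea α β γ := by
    simp only [circleArea]
    ring
  have hcos : circleArea β γ δ * Real.cos α + circleArea α β δ * Real.cos γ
      = circleArea α γ δ * Real.cos β + circleArea α β γ * Real.cos δ := by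
    simp only [circleArea, Real.sin_sub]
    ring
  have hsin : circleArea β γ δ * Real.sin α + circleArea α β δ * Real.sin γ
      = circleArea α γ δ * Real.sin β + circleArea α β γ * Real.sin δ := by
    simp only [circleArea, Real.sin_sub]
    ring
  set A := circleArea β γ δ
  set B := circleArea α β δ
  set C := circleArea α γ δ
  set D := circleArea α β γ
  have hs : 0 < A + B := by positivity
  refine ⟨(A / (A + B)) • P + (B / (A + B)) • R,
    ⟨A / (A + B), B / (A + B), by positivity, by positivity, by field_simp, rfl⟩,
    ⟨C / (A + B), D / (A + B), by positivity, by positivity, by rw [hsum]; field_simp, ?_⟩⟩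
  ext i
  fin_cases i
  · simp only [Fin.zero_eta, PiLp.add_apply, PiLp.smul_apply, smul_eq_mul, hP.1, hQ.1, hR.1, hS.1]
    field_simp
    linear_combination (-c 0) * hsum - r * hcos
  · simp only [Fin.mk_one, PiLp.add_apply, PiLp.smul_apply, smul_eq_mul, hP.2, hQ.2, hR.2, hS.2]
    field_simp
    linear_combination (-c 1) * hsum - r * hsin

namespace ConvexDrawing

variable {V : Type u} (Γ : ConvexDrawing V)

/-- The angle of a vertex of a convex drawing, as seen from the center of the circle. -/
noncomputable def angle (v : V) : ℝ :=
  Complex.arg ⟨Γ.pos v 0 - Γ.center 0, Γ.pos v 1 - Γ.center 1⟩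

theorem pos_eq (v : V) : Γ.pos v 0 = Γ.center 0 + Γ.radius * Real.cos (Γ.angle v) ∧
    Γ.pos v 1 = Γ.center 1 + Γ.radius * Real.sin (Γ.angle v) := by
  have hr : ‖(⟨Γ.pos v 0 - Γ.center 0, Γ.pos v 1 - Γ.center 1⟩ : ℂ)‖ = Γ.radius := by
    have := Γ.pos_mem v
    rw [Metric.mem_sphere, EuclideanSpace.dist_eq, Fin.sum_univ_two, Real.dist_eq, Real.dist_eq,
      sq_abs, sq_abs] at this
    rw [← this, Complex.norm_def, Complex.normSq_mk, sq, sq]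
  have h1 := Complex.norm_mul_cos_arg ⟨Γ.pos v 0 - Γ.center 0, Γ.pos v 1 - Γ.center 1⟩
  have h2 := Complex.norm_mul_sin_arg ⟨Γ.pos v 0 - Γ.center 0, Γ.pos v 1 - Γ.center 1⟩
  rw [hr] at h1 h2
  simp only [angle]
  constructor <;> linarith

theorem angle_injective : Function.Injective Γ.angle := by
  intro u v h
  refine Γ.pos_injective ?_
  have hu := Γ.pos_eq u
  have hv := Γ.pos_eq v
  rw [h] at hu
  ext i
  fin_cases i
  · exact hu.1.trans hv.1.symm
  · exact hu.2.trans hv.2.symm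

theorem openSegment_inter_nonempty {u v w x : V} (huv : Γ.angle u < Γ.angle v)
    (hvw : Γ.angle v < Γ.angle w) (hwx : Γ.angle w < Γ.angle x) :
    (openSegment ℝ (Γ.pos u) (Γ.pos w) ∩ openSegment ℝ (Γ.pos v) (Γ.pos x)).Nonempty := by
  refine openSegment_inter_openSegment_nonempty huv hvw hwx ?_ (Γ.pos_eq u) (Γ.pos_eq v)
    (Γ.pos_eq w) (Γ.pos_eq x)
  have h1 : Γ.angle x ≤ Real.pi := Complex.arg_le_pi _
  have h2 : -Real.pi < Γ.angle u := Complex.neg_pi_lt_arg _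
  linarith

end ConvexDrawing

theorem treewidth_le_four_of_outerKPlanar_two {V : Type u} [Finite V] {G : SimpleGraph V}
    (h : OuterKPlanar 2 G) : treewidth G ≤ 4 := by
  obtain ⟨Γ, hΓ⟩ := h
  obtain ⟨p, hp⟩ := exists_embedding_nat_of_injective Γ.angle_injective
  refine treewidth_le_four_of_crossingEdges p ?_
  rintro ⟨_, _⟩ hlt ⟨-, u, v, huv, rfl, rfl⟩
  -- It suffices that interleaving edges are images of geometrically crossing ones; injectivity of
  -- `g` is not needed for the count.
  let g : Sym2 V → ℕ × ℕ := fun f => ((f.map p).inf, (f.map p).sup)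
  have hsub : crossingEdges (G.map p) (p u, p v) ⊆
      g '' {f ∈ G.edgeSet | Γ.Crosses s(u, v) f} := by
    rintro ⟨_, _⟩ ⟨hlt', ⟨-, w, x, hwx, rfl, rfl⟩, hcr⟩
    refine ⟨s(w, x), ⟨hwx, ?_, ?_⟩, ?_⟩
    · rintro heq
      rcases Sym2.eq_iff.1 heq with ⟨rfl, rfl⟩ | ⟨rfl, rfl⟩ <;>
      · simp only [Interleave] at hcr
        omega
    · rcases hcr with ⟨h1, h2, h3⟩ | ⟨h1, h2, h3⟩
      · exact Γ.openSegment_inter_nonempty (hp _ _ h1) (hp _ _ h2) (hp _ _ h3)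
      · rw [Set.inter_comm]
        exact Γ.openSegment_inter_nonempty (hp _ _ h1) (hp _ _ h2) (hp _ _ h3)
    · simp only at hlt'
      simp [g, hlt'.le]
  exact (Set.encard_le_encard hsub).trans ((Set.encard_image_le _ _).trans (hΓ _ huv))

/-! ### Cliques in tree decompositions -/

open SimpleGraph in
/-- If every node of a finite tree is assigned a neighbor, then two adjacent nodes are assigned to
each other. -/
theorem SimpleGraph.IsTree.exists_swap {ι : Type*} [Finite ι] {T : SimpleGraph ι} (hT : T.IsTree)
    {f : ι → ι} (hf : ∀ i, T.Adj i (f i)) : ∃ i, f (f i) = i := by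
  have hcard := (isTree_iff_connected_and_card.1 hT).2
  let g : ι → T.edgeSet := fun i => ⟨s(i, f i), hf i⟩
  -- A tree has fewer edges than nodes, so two nodes select the same edge.
  have hg : ¬ Function.Injective g := fun h => by
    have := Nat.card_le_card_of_injective g h
    omega
  simp only [Function.Injective, not_forall] at hg
  obtain ⟨i, j, hij, hne⟩ := hg
  have hij' : s(i, f i) = s(j, f j) := congrArg Subtype.val hij
  rcases Sym2.eq_iff.1 hij' with ⟨h, -⟩ | ⟨h1, h2⟩
  · exact absurd h hne
  · exact ⟨i, by rw [h2, ← h1]⟩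

theorem SimpleGraph.Walk.reachable_deleteEdges_of_notMem_support {ι : Type*} {T : SimpleGraph ι}
    {x y i j : ι} (p : T.Walk x y) (hi : i ∉ p.support) :
    (T.deleteEdges {s(i, j)}).Reachable x y :=
  ⟨p.toDeleteEdge s(i, j) fun h => hi (p.fst_mem_support_of_mem_edges h)⟩

theorem SimpleGraph.Preconnected.reachable_deleteEdges_of_induce {ι : Type*} {T : SimpleGraph ι}
    {A : Set ι} (hA : (T.induce A).Preconnected) {x y i j : ι} (hx : x ∈ A) (hy : y ∈ A)
    (hi : i ∉ A) : (T.deleteEdges {s(i, j)}).Reachable x y := by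
  obtain ⟨p⟩ := hA ⟨x, hx⟩ ⟨y, hy⟩
  have hq : i ∉ (p.map (SimpleGraph.Embedding.induce A).toHom).support := fun h => by
    rw [SimpleGraph.Walk.support_map, List.mem_map] at h
    obtain ⟨z, -, rfl⟩ := h
    exact hi z.2
  exact SimpleGraph.Walk.reachable_deleteEdges_of_notMem_support _ hq

/-- Every clique is contained in a bag of a tree decomposition. -/
theorem TreeDecomposition.exists_subset_bag {V : Type u} {G : SimpleGraph V}
    (D : TreeDecomposition G) {s : Set V} (hs : G.IsClique s) : ∃ i, s ⊆ D.bag i := by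
  by_contra! hno
  simp only [Set.not_subset] at hno
  choose v hvs hv using hno
  choose t ht using fun i => D.vertex_mem (v i)
  have hne : ∀ i, i ≠ t i := fun i h => hv i (by have := ht i; rwa [← h] at this)
  -- Every node i misses some clique vertex `v i`; it points to its neighbor on the way to a bag
  -- containing `v i`.
  have hstep : ∀ i, ∃ j, D.tree.Adj i j ∧
      ∀ k, (D.tree.deleteEdges {s(i, k)}).Reachable j (t i) := by
    intro i
    obtain ⟨p, hp⟩ := D.isTree.connected.exists_isPath i (t i)
    generalize hti : t i = y at p
    cases p with
    | nil => exact absurd hti.symm (hne i)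
    | cons h q =>
      rw [SimpleGraph.Walk.cons_isPath_iff] at hp
      exact ⟨_, h, fun k => q.reachable_deleteEdges_of_notMem_support hp.2⟩
  choose f hadj hreach using hstep
  -- Some tree edge is pointed along both ways, so the subtrees of its two missed vertices lie on
  -- opposite sides of it. These vertices are equal or adjacent and share a bag, so the edge would
  -- not be a bridge.
  obtain ⟨i, hi⟩ := D.isTree.exists_swap hadj
  obtain ⟨z, hz₁, hz₂⟩ : ∃ z, v i ∈ D.bag z ∧ v (f i) ∈ D.bag z := by
    by_cases h : v i = v (f i)
    · exact ⟨t i, ht i, h ▸ ht i⟩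
    · exact D.edge_mem _ _ (hs (hvs i) (hvs (f i)) h)
  have h1 := hreach i (f i)
  have h2 := hreach (f i) i
  rw [hi, Sym2.eq_swap] at h2
  have h3 := (D.subtree (v i)).preconnected.reachable_deleteEdges_of_induce (j := f i)
    (ht i) hz₁ (hv i)
  have h4 := (D.subtree (v (f i))).preconnected.reachable_deleteEdges_of_induce (j := i)
    (ht (f i)) hz₂ (hv (f i))
  rw [Sym2.eq_swap] at h4
  have hbridge := SimpleGraph.isAcyclic_iff_forall_adj_isBridge.1 D.isTree.isAcyclic (hadj i)
  rw [SimpleGraph.isBridge_iff] at hbridge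
  exact hbridge ((h2.trans h4).trans (h1.trans h3).symm)

theorem card_sub_one_le_treewidth_completeGraph (V : Type u) [Fintype V] :
    (Fintype.card V : ℤ) - 1 ≤ treewidth (SimpleGraph.completeGraph V) := by
  obtain ⟨D, hD⟩ := (isLeast_treewidth (SimpleGraph.completeGraph V)).1
  obtain ⟨i, hi⟩ := D.exists_subset_bag (s := Set.univ) (by
    intro v _ w _ h
    exact h)
  have h1 : Fintype.card V ≤ (D.bag i).card := by
    rw [← Finset.card_univ]
    exact Finset.card_le_card fun x _ => hi (Set.mem_univ x)
  have h2 := h1.trans (Finset.le_sup (f := fun i => (D.bag i).card) (Finset.mem_univ i))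
  rw [← hD]
  simp only [TreeDecomposition.width]
  omega

/-! ### An explicit drawing of the complete graph on five vertices -/

/-- Five lattice points on a circle of radius five, in counterclockwise order. -/
def pentagon : Fin 5 → ℤ × ℤ := ![(5, 0), (3, 4), (-3, 4), (-3, -4), (3, -4)]

/-- Twice the signed area of the triangle spanned by three lattice points. -/
def orient (P Q R : ℤ × ℤ) : ℤ := (Q.1 - P.1) * (R.2 - P.2) - (Q.2 - P.2) * (R.1 - P.1)

/-- The convex drawing with the vertices at the points of `pentagon`. -/
noncomputable def pentagonDrawing : ConvexDrawing (Fin 5) where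
  center := 0
  radius := 5
  radius_pos := by norm_num
  pos v := !₂[((pentagon v).1 : ℝ), ((pentagon v).2 : ℝ)]
  pos_mem v := by
    have h : (pentagon v).1 ^ 2 + (pentagon v).2 ^ 2 = 25 := by
      revert v
      decide
    have h' : ((pentagon v).1 : ℝ) ^ 2 + ((pentagon v).2 : ℝ) ^ 2 = 5 ^ 2 := by
      norm_num
      exact_mod_cast h
    rw [mem_sphere_zero_iff_norm, EuclideanSpace.norm_eq, Fin.sum_univ_two]
    simp only [Real.norm_eq_abs, sq_abs]
    simp only [Matrix.cons_val_zero, Matrix.cons_val_one]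
    rw [h', Real.sqrt_sq (by norm_num)]
  pos_injective := by
    have h : Function.Injective pentagon := by decide
    intro u v huv
    refine h (Prod.ext ?_ ?_)
    · simpa using congrArg (fun x : Plane => x 0) huv
    · simpa using congrArg (fun x : Plane => x 1) huv

/-- Crossing edges of the pentagon drawing have their endpoints on different sides of each
other. -/
theorem orient_mul_orient_neg {u v w x : Fin 5} (huv : u ≠ v) (hwx : w ≠ x)
    (h : pentagonDrawing.Crosses s(u, v) s(w, x)) :
    orient (pentagon u) (pentagon v) (pentagon w) * orient (pentagon u) (pentagon v) (pentagon x)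
      < 0 := by
  obtain ⟨hne, P, ⟨a, b, ha, hb, hab, rfl⟩, ⟨c, d, hc, hd, hcd, hP⟩⟩ := h
  have h0 := congrArg (fun x : Plane => x 0) hP
  have h1 := congrArg (fun x : Plane => x 1) hP
  simp only [pentagonDrawing, PiLp.add_apply, PiLp.smul_apply,
    Matrix.cons_val_zero, Matrix.cons_val_one, smul_eq_mul] at h0 h1
  -- Orientation relative to u and v is affine in the third point and vanishes at the crossing
  -- point, a convex combination of w and x.
  have key : c * (orient (pentagon u) (pentagon v) (pentagon w) : ℝ)
      + d * (orient (pentagon u) (pentagon v) (pentagon x) : ℝ) = 0 := by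
    simp only [orient]
    push_cast
    obtain rfl : b = 1 - a := by linarith
    obtain rfl : d = 1 - c := by linarith
    linear_combination (((pentagon v).1 : ℝ) - (pentagon u).1) * h1
      - (((pentagon v).2 : ℝ) - (pentagon u).2) * h0
  have hnz : ¬ (orient (pentagon u) (pentagon v) (pentagon w) = 0 ∧
      orient (pentagon u) (pentagon v) (pentagon x) = 0) := by
    clear hP h0 h1 key
    revert u v w x
    decide
  generalize orient (pentagon u) (pentagon v) (pentagon w) = m at *
  generalize orient (pentagon u) (pentagon v) (pentagon x) = n at *
  have hm : (c * (m * n : ℤ) : ℝ) = -(d * (n : ℝ) ^ 2) := by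
    push_cast
    linear_combination (n : ℝ) * key
  by_contra! hmn
  have hmn' : (0 : ℝ) ≤ (m * n : ℤ) := by exact_mod_cast hmn
  have hn : (n : ℝ) = 0 := by
    have h2 : d * (n : ℝ) ^ 2 ≤ 0 := by
      have := mul_nonneg hc.le hmn'
      linarith
    have h3 : (n : ℝ) ^ 2 ≤ 0 := nonpos_of_mul_nonpos_right h2 hd
    exact pow_eq_zero_iff two_ne_zero |>.1 (le_antisymm h3 (sq_nonneg _))
  have hm' : (m : ℝ) = 0 := by
    rw [hn] at key
    simpa [hc.ne'] using key
  exact hnz ⟨by exact_mod_cast hm', by exact_mod_cast hn⟩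

theorem outerKPlanar_two_completeGraph_five :
    OuterKPlanar 2 (SimpleGraph.completeGraph (Fin 5)) := by
  refine ⟨pentagonDrawing, ?_⟩
  intro e he
  induction e with
  | h u v =>
    have huv : u ≠ v := he
    -- The sign test over the integers yields a decidable superset of the crossing edges, small
    -- enough to enumerate.
    let F : Finset (Sym2 (Fin 5)) := ((Finset.univ : Finset (Fin 5 × Fin 5)).filter fun q =>
      orient (pentagon u) (pentagon v) (pentagon q.1) *
        orient (pentagon u) (pentagon v) (pentagon q.2) < 0).image fun q => s(q.1, q.2)
    have hF : F.card ≤ 2 := by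
      revert u v
      decide
    refine le_trans (Set.encard_le_encard (t := (F : Set (Sym2 (Fin 5)))) ?_) ?_
    · rintro f ⟨hwx, hf⟩
      induction f with
      | h w x => exact Finset.mem_coe.2 (Finset.mem_image.2 ⟨(w, x), by
          simpa using orient_mul_orient_neg huv hwx hf, rfl⟩)
    · rw [Set.encard_coe_eq_coe_finsetCard]
      exact_mod_cast hF

theorem mainTheorem2 :
    (∀ (V : Type u) [Finite V] (G : SimpleGraph V), OuterKPlanar 2 G → treewidth G ≤ 4) ∧
    OuterKPlanar 2 (SimpleGraph.completeGraph (Fin 5)) ∧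
    treewidth (SimpleGraph.completeGraph (Fin 5)) = 4 := by
  refine ⟨fun V _ G h => treewidth_le_four_of_outerKPlanar_two h,
    outerKPlanar_two_completeGraph_five, le_antisymm
      (treewidth_le_four_of_outerKPlanar_two outerKPlanar_two_completeGraph_five) ?_⟩
  simpa using card_sub_one_le_treewidth_completeGraph (Fin 5)
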